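/- Let $\mathfrak A$ and $\mathcal A$ be complex Banach algebras (not necessarily unital) such that $\mathcal A$ is a Banach $\mathfrak A$-bimodule with compatible actions, i.e. $\alpha\cdot(ab)=(\alpha\cdot a)b$ and $(ab)\cdot\alpha=a(b\cdot\alpha)$ for all $a,b\in\mathcal A$, $\alpha\in\mathfrak A$. Let $I_{\mathcal A}$ be the closed linear span in the projective tensor product $\mathcal A\widehat\otimes\mathcal A$ of the elements $a\cdot\alpha\otimes b-a\otimes\alpha\cdot b$, let $J_{\mathcal A}$ be the closed two-sided ideal of $\mathcal A$ generated by the elements $(a\cdot\alpha)b-a(\alpha\cdot b)$, put $\mathcal A\widehat\otimes_{\mathfrak A}\mathcal A=(\mathcal A\widehat\otimes\mathcal A)/I_{\mathcal A}$, and let $\widetilde\omega:\mathcal A\widehat\otimes_{\mathfrak A}\mathcal A\to\mathcal A/J_{\mathcal A}$ be the bounded linear map with $\widetilde\omega(a\otimes b+I_{\mathcal A})=ab+J_{\mathcal A}$. The algebra $\mathcal A$ and the algebra $\mathfrak A$ act on $\mathcal A\widehat\otimes_{\mathfrak A}\mathcal A$ by $x\cdot(a\otimes b)=(x\cdot a)\otimes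 b$, $(a\otimes b)\cdot x=a\otimes(b\cdot x)$, and on $\mathcal A/J_{\mathcal A}$ canonically; a dual space carries the dual actions $(x\cdot f)(y)=f(y\cdot x)$, $(f\cdot x)(y)=f(x\cdot y)$. The algebra $\mathcal A$ is called module biflat (as an $\mathfrak A$-bimodule) if there is a bounded linear map $\theta:(\mathcal A\widehat\otimes_{\mathfrak A}\mathcal A)^*\to(\mathcal A/J_{\mathcal A})^*$ with $\theta\circ\widetilde\omega^*=\mathrm{id}$ that is an $\mathcal A/J_{\mathcal A}$-$\mathfrak A$-module homomorphism, that is, $\theta$ respects the left and right actions of $\mathfrak A$ and of $\mathcal A$ (the class $a+J_{\mathcal A}$ acting as $a$ does). Equip $\mathcal A^{**}$ with the first Arens product $(F\,\square\,G)(f)=F(G\cdot f)$, where $(G\cdot f)(a)=G(f\cdot a)$ and $(f\cdot a)(b)=f(ab)$ for $f\in\mathcal A^*$, $a,b\in\mathcal A$, and with the second dual $\mathfrak A$-bimodule actions; this is again a Banach algebra and a Banach $\mathfrak A$-bimodule with compatible actions. Theorem. If $\mathcal A^{**}$ is module biflat (as an $\mathfrak A$-bimodule), then $\mathcal A$ is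 module biflat (as an $\mathfrak A$-bimodule). -/

import Mathlib

noncomputable section

open scoped TensorProduct

namespace ModBiflat

/-! ### Banach bimodules over a (not necessarily unital) Banach algebra -/

/-- A Banach `R`-bimodule structure on `X`: `left α x = α · x` and `right α x = x · α` are
bounded bilinear actions of the Banach algebra `R`, and they commute. -/
structure BanachBimodule (R X : Type*) [NonUnitalNormedRing R] [NormedSpace ℂ R]
    [NormedAddCommGroup X] [NormedSpace ℂ X] where
  left : R →L[ℂ] X →L[ℂ] X
  right : R →L[ℂ] X →L[ℂ] X
  left_mul : ∀ α β x, left (α * β) x = left α (left β x)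
  right_mul : ∀ α β x, right (α * β) x = right β (right α x)
  left_right : ∀ α β x, left α (right β x) = right β (left α x)

namespace BanachBimodule

section
variable {R X Y : Type*} [NonUnitalNormedRing R] [NormedSpace ℂ R]
  [NormedAddCommGroup X] [NormedSpace ℂ X] [NormedAddCommGroup Y] [NormedSpace ℂ Y]

/-- The dual bimodule: `(α · f)(x) = f (x · α)` and `(f · α)(x) = f (α · x)`. -/
def dual (m : BanachBimodule R X) : BanachBimodule R (StrongDual ℂ X) where
  left := (ContinuousLinearMap.compL ℂ X X ℂ).flip ∘L m.right
  right := (ContinuousLinearMap.compL ℂ X X ℂ).flip ∘L m.left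
  left_mul α β f := by ext x; simp [m.right_mul]
  right_mul α β f := by ext x; simp [m.left_mul]
  left_right α β f := by ext x; simp [m.left_right]

@[simp] theorem dual_left_apply (m : BanachBimodule R X) (α : R) (f : StrongDual ℂ X) (x : X) :
    m.dual.left α f x = f (m.right α x) := rfl

@[simp] theorem dual_right_apply (m : BanachBimodule R X) (α : R) (f : StrongDual ℂ X) (x : X) :
    m.dual.right α f x = f (m.left α x) := rfl

/-- `T` respects both module actions of `R`. -/
def IsHom (m : BanachBimodule R X) (n : BanachBimodule R Y) (T : X →L[ℂ] Y) : Prop :=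
  (∀ α x, T (m.left α x) = n.left α (T x)) ∧ ∀ α x, T (m.right α x) = n.right α (T x)

end

section Quotient
variable {R X : Type*} [NonUnitalNormedRing R] [NormedSpace ℂ R]
  [NormedAddCommGroup X] [NormedSpace ℂ X]

/-- The operator induced on `X ⧸ S` by a bounded operator that maps `S` into itself. -/
def mapQ (S : Submodule ℂ X) (f : X →L[ℂ] X) (h : ∀ x ∈ S, f x ∈ S) : (X ⧸ S) →L[ℂ] X ⧸ S :=
  S.liftQL (S.mkQL ∘L f) fun x hx => by
    simpa using h x hx

@[simp] theorem mapQ_mk (S : Submodule ℂ X) (f : X →L[ℂ] X) (h : ∀ x ∈ S, f x ∈ S) (x : X) :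
    mapQ S f h (Submodule.Quotient.mk x) = Submodule.Quotient.mk (f x) := rfl

theorem norm_mapQ_le (S : Submodule ℂ X) (f : X →L[ℂ] X) (h : ∀ x ∈ S, f x ∈ S) :
    ‖mapQ S f h‖ ≤ ‖f‖ := by
  refine ContinuousLinearMap.opNorm_le_bound _ (norm_nonneg _) fun q => ?_
  refine le_of_forall_pos_le_add fun ε hε => ?_
  have hδ : 0 < ε / (‖f‖ + 1) := by positivity
  obtain ⟨x, rfl, hx⟩ := Submodule.Quotient.norm_mk_lt q hδ
  rw [mapQ_mk]
  calc ‖(Submodule.Quotient.mk (f x) : X ⧸ S)‖ ≤ ‖f x‖ := Submodule.Quotient.norm_mk_le _ _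
    _ ≤ ‖f‖ * ‖x‖ := f.le_opNorm x
    _ ≤ ‖f‖ * (‖(Submodule.Quotient.mk x : X ⧸ S)‖ + ε / (‖f‖ + 1)) := by gcongr
    _ = ‖f‖ * ‖(Submodule.Quotient.mk x : X ⧸ S)‖ + ε * (‖f‖ / (‖f‖ + 1)) := by ring
    _ ≤ _ := by
      have : ‖f‖ / (‖f‖ + 1) ≤ 1 := by
        rw [div_le_one (by positivity)]; linarith
      nlinarith

/-- A family of operators depending boundedly and linearly on `R`, passed to the quotient. -/
def actQ (S : Submodule ℂ X) (l : R →L[ℂ] X →L[ℂ] X) (h : ∀ α, ∀ x ∈ S, l α x ∈ S) :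
    R →L[ℂ] (X ⧸ S) →L[ℂ] X ⧸ S :=
  LinearMap.mkContinuous
    { toFun := fun α => mapQ S (l α) (h α)
      map_add' := fun α β => by
        ext q; obtain ⟨x, rfl⟩ := Submodule.Quotient.mk_surjective S q; simp
      map_smul' := fun c α => by
        ext q; obtain ⟨x, rfl⟩ := Submodule.Quotient.mk_surjective S q; simp }
    ‖l‖ fun α => (norm_mapQ_le S (l α) (h α)).trans (l.le_opNorm α)

@[simp] theorem actQ_mk (S : Submodule ℂ X) (l : R →L[ℂ] X →L[ℂ] X)
    (h : ∀ α, ∀ x ∈ S, l α x ∈ S) (α : R) (x : X) :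
    actQ S l h α (Submodule.Quotient.mk x) = Submodule.Quotient.mk (l α x) := rfl

/-- The quotient of a Banach bimodule by a closed subbimodule. -/
def quotient (m : BanachBimodule R X) (S : Submodule ℂ X) [IsClosed (S : Set X)]
    (hl : ∀ α, ∀ x ∈ S, m.left α x ∈ S) (hr : ∀ α, ∀ x ∈ S, m.right α x ∈ S) :
    BanachBimodule R (X ⧸ S) where
  left := actQ S m.left hl
  right := actQ S m.right hr
  left_mul α β q := by
    obtain ⟨x, rfl⟩ := Submodule.Quotient.mk_surjective S q; simp [m.left_mul]
  right_mul α β q := by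
    obtain ⟨x, rfl⟩ := Submodule.Quotient.mk_surjective S q; simp [m.right_mul]
  left_right α β q := by
    obtain ⟨x, rfl⟩ := Submodule.Quotient.mk_surjective S q; simp [m.left_right]

end Quotient

/-- A Banach algebra as a Banach bimodule over itself, acting by multiplication. -/
def self (A : Type*) [NonUnitalNormedRing A] [NormedSpace ℂ A] [IsScalarTower ℂ A A]
    [SMulCommClass ℂ A A] : BanachBimodule A A where
  left := ContinuousLinearMap.mul ℂ A
  right := (ContinuousLinearMap.mul ℂ A).flip
  left_mul a b x := by simp [mul_assoc]
  right_mul a b x := by simp [mul_assoc]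
  left_right a b x := by simp [mul_assoc]

end BanachBimodule

/-! ### The completed projective tensor product `A ⊗̂ A` -/

/-- `A ⊗̂ A`: the completion of the algebraic tensor product in the projective norm. -/
abbrev ProjTensor (A : Type*) [NormedAddCommGroup A] [NormedSpace ℂ A] : Type _ :=
  UniformSpace.Completion (⨂[ℂ] _ : Fin 2, A)

namespace ProjTensor

theorem update_zero {B : Type*} (a b x : B) : Function.update ![a, b] 0 x = ![x, b] := by
  ext i; fin_cases i <;> rfl

theorem update_one {B : Type*} (a b x : B) : Function.update ![a, b] 1 x = ![a, x] := by
  ext i; fin_cases i <;> rfl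

section
variable {A : Type*} [NormedAddCommGroup A] [NormedSpace ℂ A]

/-- The elementary tensor `a ⊗ b`. -/
def tmul (a b : A) : ProjTensor A :=
  ((PiTensorProduct.tprod ℂ ![a, b] : ⨂[ℂ] _ : Fin 2, A) : ProjTensor A)

theorem ext_tmul {F : Type*} [NormedAddCommGroup F] [NormedSpace ℂ F]
    {f g : ProjTensor A →L[ℂ] F} (h : ∀ a b, f (tmul a b) = g (tmul a b)) : f = g := by
  have key : ∀ x : ⨂[ℂ] _ : Fin 2, A, f (x : ProjTensor A) = g (x : ProjTensor A) := by
    intro x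
    induction x using PiTensorProduct.induction_on with
    | smul_tprod r v =>
      have hv : v = ![v 0, v 1] := by ext i; fin_cases i <;> rfl
      rw [UniformSpace.Completion.coe_smul, map_smul, map_smul, hv]
      exact congrArg (r • ·) (h (v 0) (v 1))
    | add x y hx hy => rw [UniformSpace.Completion.coe_add, map_add, map_add, hx, hy]
  ext x
  induction x using UniformSpace.Completion.induction_on with
  | hp => exact isClosed_eq f.continuous g.continuous
  | ih x => exact key x

/-- The bounded operator `f ⊗ g` on `A ⊗̂ A`. -/
def map (f g : A →L[ℂ] A) : ProjTensor A →L[ℂ] ProjTensor A :=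
  (PiTensorProduct.mapL (𝕜 := ℂ) (E := fun _ : Fin 2 => A) (E' := fun _ : Fin 2 => A)
    ![f, g]).completion

@[simp] theorem map_tmul (f g : A →L[ℂ] A) (a b : A) :
    map f g (tmul a b) = tmul (f a) (g b) := by
  unfold map tmul
  rw [ContinuousLinearMap.completion_apply_coe, PiTensorProduct.mapL_apply,
    PiTensorProduct.map_tprod]
  congr 2
  ext i
  fin_cases i <;> rfl

theorem norm_map_le (f g : A →L[ℂ] A) : ‖map f g‖ ≤ ‖f‖ * ‖g‖ := by
  refine ContinuousLinearMap.opNorm_le_bound _ (by positivity) fun x => ?_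
  induction x using UniformSpace.Completion.induction_on with
  | hp => exact isClosed_le (by fun_prop) (by fun_prop)
  | ih x =>
    unfold map
    rw [ContinuousLinearMap.completion_apply_coe, UniformSpace.Completion.norm_coe,
      UniformSpace.Completion.norm_coe]
    refine (ContinuousLinearMap.le_opNorm _ x).trans ?_
    gcongr
    simpa using PiTensorProduct.opNorm_mapL (𝕜 := ℂ) (E := fun _ : Fin 2 => A)
      (E' := fun _ : Fin 2 => A) ![f, g]

theorem tmul_add_left (a a' b : A) : tmul (a + a') b = tmul a b + tmul a' b := by
  have := (PiTensorProduct.tprod ℂ (s := fun _ : Fin 2 => A)).map_update_add ![a, b] 0 a a'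
  rw [update_zero, update_zero, update_zero] at this
  rw [tmul, this, UniformSpace.Completion.coe_add, tmul, tmul]

theorem tmul_add_right (a b b' : A) : tmul a (b + b') = tmul a b + tmul a b' := by
  have := (PiTensorProduct.tprod ℂ (s := fun _ : Fin 2 => A)).map_update_add ![a, b] 1 b b'
  rw [update_one, update_one, update_one] at this
  rw [tmul, this, UniformSpace.Completion.coe_add, tmul, tmul]

theorem tmul_smul_left (c : ℂ) (a b : A) : tmul (c • a) b = c • tmul a b := by
  have := (PiTensorProduct.tprod ℂ (s := fun _ : Fin 2 => A)).map_update_smul ![a, b] 0 c a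
  rw [update_zero, update_zero] at this
  rw [tmul, this, UniformSpace.Completion.coe_smul, tmul]

theorem tmul_smul_right (c : ℂ) (a b : A) : tmul a (c • b) = c • tmul a b := by
  have := (PiTensorProduct.tprod ℂ (s := fun _ : Fin 2 => A)).map_update_smul ![a, b] 1 c b
  rw [update_one, update_one] at this
  rw [tmul, this, UniformSpace.Completion.coe_smul, tmul]

/-- `f ↦ f ⊗ id`. -/
def mapLeft : (A →L[ℂ] A) →L[ℂ] ProjTensor A →L[ℂ] ProjTensor A :=
  LinearMap.mkContinuous
    { toFun := fun f => map f (ContinuousLinearMap.id ℂ A)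
      map_add' := fun f g => ext_tmul fun a b => by simp [tmul_add_left]
      map_smul' := fun c f => ext_tmul fun a b => by simp [tmul_smul_left] }
    1 fun f => by
      refine (norm_map_le _ _).trans ?_
      rw [one_mul]
      exact mul_le_of_le_one_right (norm_nonneg _) ContinuousLinearMap.norm_id_le

/-- `g ↦ id ⊗ g`. -/
def mapRight : (A →L[ℂ] A) →L[ℂ] ProjTensor A →L[ℂ] ProjTensor A :=
  LinearMap.mkContinuous
    { toFun := fun g => map (ContinuousLinearMap.id ℂ A) g
      map_add' := fun f g => ext_tmul fun a b => by simp [tmul_add_right]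
      map_smul' := fun c f => ext_tmul fun a b => by simp [tmul_smul_right] }
    1 fun g => by
      refine (norm_map_le _ _).trans ?_
      exact mul_le_mul_of_nonneg_right ContinuousLinearMap.norm_id_le (norm_nonneg _)

@[simp] theorem mapLeft_tmul (f : A →L[ℂ] A) (a b : A) :
    mapLeft f (tmul a b) = tmul (f a) b := map_tmul _ _ _ _

@[simp] theorem mapRight_tmul (g : A →L[ℂ] A) (a b : A) :
    mapRight g (tmul a b) = tmul a (g b) := map_tmul _ _ _ _

end

/-- If `A` is a Banach `R`-bimodule, so is `A ⊗̂ A`, with `α · (a ⊗ b) = (α · a) ⊗ b` and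
`(a ⊗ b) · α = a ⊗ (b · α)`. -/
def bimodule {R A : Type*} [NonUnitalNormedRing R] [NormedSpace ℂ R]
    [NormedAddCommGroup A] [NormedSpace ℂ A] (m : BanachBimodule R A) :
    BanachBimodule R (ProjTensor A) where
  left := mapLeft ∘L m.left
  right := mapRight ∘L m.right
  left_mul α β x := by
    have : mapLeft (m.left (α * β)) = mapLeft (m.left α) ∘L mapLeft (m.left β) :=
      ext_tmul fun a b => by simp [m.left_mul]
    exact DFunLike.congr_fun this x
  right_mul α β x := by
    have : mapRight (m.right (α * β)) = mapRight (m.right β) ∘L mapRight (m.right α) :=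
      ext_tmul fun a b => by simp [m.right_mul]
    exact DFunLike.congr_fun this x
  left_right α β x := by
    have : mapLeft (m.left α) ∘L mapRight (m.right β) =
        mapRight (m.right β) ∘L mapLeft (m.left α) :=
      ext_tmul fun a b => by simp
    exact DFunLike.congr_fun this x

/-- The product map `ω : A ⊗̂ A → A`, `ω (a ⊗ b) = a b`. -/
def prod (A : Type*) [NonUnitalNormedRing A] [NormedSpace ℂ A] [IsScalarTower ℂ A A]
    [SMulCommClass ℂ A A] [CompleteSpace A] : ProjTensor A →L[ℂ] A :=
  (PiTensorProduct.liftIsometry ℂ (fun _ : Fin 2 => A) A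
    (MultilinearMap.mkContinuous
      (MultilinearMap.mk' (fun v : Fin 2 → A => v 0 * v 1)
        (fun v i x y => by fin_cases i <;> simp [add_mul, mul_add])
        (fun v i c x => by fin_cases i <;> simp [smul_mul_assoc, mul_smul_comm]))
      1 fun v => by simpa using norm_mul_le (v 0) (v 1))).fromCompletion

@[simp] theorem prod_tmul {A : Type*} [NonUnitalNormedRing A] [NormedSpace ℂ A]
    [IsScalarTower ℂ A A] [SMulCommClass ℂ A A] [CompleteSpace A] (a b : A) :
    prod A (tmul a b) = a * b := by
  unfold prod tmul
  rw [ContinuousLinearMap.fromCompletion_apply_coe]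
  simp

end ProjTensor

/-! ### Compatible actions, the subspaces `I` and `J`, and module biflatness -/

/-- A Banach `𝔄`-bimodule structure on the Banach algebra `A` with compatible actions:
`α · (a b) = (α · a) b` and `(a b) · α = a (b · α)`. -/
structure CompatibleBimodule (𝔄 A : Type*) [NonUnitalNormedRing 𝔄] [NormedSpace ℂ 𝔄]
    [NonUnitalNormedRing A] [NormedSpace ℂ A] extends BanachBimodule 𝔄 A where
  left_comp : ∀ α a b, left α (a * b) = left α a * b
  right_comp : ∀ α a b, right α (a * b) = a * right α b

/-- The closed two-sided ideal of `A` generated by `s`. -/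
def closedIdeal {A : Type*} [NonUnitalNormedRing A] [NormedSpace ℂ A] (s : Set A) :
    Submodule ℂ A :=
  sInf {K | IsClosed (K : Set A) ∧ s ⊆ K ∧ ∀ a, ∀ x ∈ K, a * x ∈ K ∧ x * a ∈ K}

namespace CompatibleBimodule

section
variable {𝔄 A : Type*} [NonUnitalNormedRing 𝔄] [NormedSpace ℂ 𝔄]
  [NonUnitalNormedRing A] [NormedSpace ℂ A]

/-- `J`: the closed ideal of `A` generated by the elements `(a · α) b - a (α · b)`. -/
def J (m : CompatibleBimodule 𝔄 A) : Submodule ℂ A :=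
  closedIdeal {x | ∃ α a b, x = m.right α a * b - a * m.left α b}

/-- `I`: the closed linear span in `A ⊗̂ A` of the elements `a · α ⊗ b - a ⊗ α · b`. -/
def I (m : CompatibleBimodule 𝔄 A) : Submodule ℂ (ProjTensor A) :=
  (Submodule.span ℂ {x | ∃ α a b, x = ProjTensor.tmul (m.right α a) b -
    ProjTensor.tmul a (m.left α b)}).topologicalClosure

instance isClosed_J (m : CompatibleBimodule 𝔄 A) : IsClosed (m.J : Set A) := by
  unfold J closedIdeal
  rw [Submodule.coe_sInf]
  exact isClosed_biInter fun K hK => hK.1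

instance isClosed_I (m : CompatibleBimodule 𝔄 A) : IsClosed (m.I : Set (ProjTensor A)) :=
  Submodule.isClosed_topologicalClosure _

theorem subset_J (m : CompatibleBimodule 𝔄 A) (α : 𝔄) (a b : A) :
    m.right α a * b - a * m.left α b ∈ m.J :=
  Submodule.mem_sInf.2 fun _ hK => hK.2.1 ⟨α, a, b, rfl⟩

theorem mul_mem_J (m : CompatibleBimodule 𝔄 A) (a : A) {x : A} (hx : x ∈ m.J) : a * x ∈ m.J :=
  Submodule.mem_sInf.2 fun K hK => (hK.2.2 a x (Submodule.mem_sInf.1 hx K hK)).1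

theorem mem_J_mul (m : CompatibleBimodule 𝔄 A) (a : A) {x : A} (hx : x ∈ m.J) : x * a ∈ m.J :=
  Submodule.mem_sInf.2 fun K hK => (hK.2.2 a x (Submodule.mem_sInf.1 hx K hK)).2

theorem J_le (m : CompatibleBimodule 𝔄 A) {K : Submodule ℂ A} (hK : IsClosed (K : Set A))
    (h : ∀ α a b, m.right α a * b - a * m.left α b ∈ K)
    (hi : ∀ a, ∀ x ∈ K, a * x ∈ K ∧ x * a ∈ K) : m.J ≤ K :=
  sInf_le ⟨hK, by rintro _ ⟨α, a, b, rfl⟩; exact h α a b, hi⟩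

theorem left_mem_J (m : CompatibleBimodule 𝔄 A) (α : 𝔄) : ∀ x ∈ m.J, m.left α x ∈ m.J := by
  have key : m.J ≤ m.J ⊓ m.J.comap (m.left α).toLinearMap := by
    refine m.J_le ?_ ?_ ?_
    · exact (m.isClosed_J).inter ((m.isClosed_J).preimage (m.left α).continuous)
    · intro β a b
      refine ⟨m.subset_J β a b, ?_⟩
      change m.left α (m.right β a * b - a * m.left β b) ∈ m.J
      rw [map_sub, m.left_comp, m.left_comp, m.left_right]
      exact m.subset_J β (m.left α a) b
    · rintro a x ⟨hx, hx'⟩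
      refine ⟨⟨m.mul_mem_J a hx, ?_⟩, ⟨m.mem_J_mul a hx, ?_⟩⟩
      · change m.left α (a * x) ∈ m.J
        rw [m.left_comp]
        exact m.mul_mem_J _ hx
      · change m.left α (x * a) ∈ m.J
        rw [m.left_comp]
        exact m.mem_J_mul _ hx'
  exact fun x hx => (key hx).2

theorem right_mem_J (m : CompatibleBimodule 𝔄 A) (α : 𝔄) : ∀ x ∈ m.J, m.right α x ∈ m.J := by
  have key : m.J ≤ m.J ⊓ m.J.comap (m.right α).toLinearMap := by
    refine m.J_le ?_ ?_ ?_
    · exact (m.isClosed_J).inter ((m.isClosed_J).preimage (m.right α).continuous)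
    · intro β a b
      refine ⟨m.subset_J β a b, ?_⟩
      change m.right α (m.right β a * b - a * m.left β b) ∈ m.J
      rw [map_sub, m.right_comp, m.right_comp, ← m.left_right]
      exact m.subset_J β a (m.right α b)
    · rintro a x ⟨hx, hx'⟩
      refine ⟨⟨m.mul_mem_J a hx, ?_⟩, ⟨m.mem_J_mul a hx, ?_⟩⟩
      · change m.right α (a * x) ∈ m.J
        rw [m.right_comp]
        exact m.mul_mem_J _ hx'
      · change m.right α (x * a) ∈ m.J
        rw [m.right_comp]
        exact m.mem_J_mul _ hx
  exact fun x hx => (key hx).2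

theorem subset_I (m : CompatibleBimodule 𝔄 A) (α : 𝔄) (a b : A) :
    ProjTensor.tmul (m.right α a) b - ProjTensor.tmul a (m.left α b) ∈ m.I :=
  Submodule.le_topologicalClosure _ (Submodule.subset_span ⟨α, a, b, rfl⟩)

theorem I_le_comap (m : CompatibleBimodule 𝔄 A) {F : Type*} [NormedAddCommGroup F]
    [NormedSpace ℂ F] (T : ProjTensor A →L[ℂ] F) {K : Submodule ℂ F} (hK : IsClosed (K : Set F))
    (h : ∀ α a b, T (ProjTensor.tmul (m.right α a) b) - T (ProjTensor.tmul a (m.left α b)) ∈ K) :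
    ∀ x ∈ m.I, T x ∈ K := by
  have : m.I ≤ K.comap T.toLinearMap := by
    refine Submodule.topologicalClosure_minimal _ ?_ (hK.preimage T.continuous)
    rw [Submodule.span_le]
    rintro _ ⟨α, a, b, rfl⟩
    change T _ ∈ K
    rw [map_sub]
    exact h α a b
  exact fun x hx => this hx

/-- `A ⊗̂_𝔄 A = (A ⊗̂ A) / I`, the module projective tensor product. -/
abbrev ModTensor (m : CompatibleBimodule 𝔄 A) : Type _ := ProjTensor A ⧸ m.I

/-- `A / J`. -/
abbrev QuotJ (m : CompatibleBimodule 𝔄 A) : Type _ := A ⧸ m.J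

/-- `A ⊗̂_𝔄 A` as a Banach `𝔄`-bimodule. -/
def modTensor𝔄 (m : CompatibleBimodule 𝔄 A) : BanachBimodule 𝔄 m.ModTensor :=
  (ProjTensor.bimodule m.toBanachBimodule).quotient m.I
    (fun α => m.I_le_comap (ProjTensor.mapLeft (m.left α)) m.isClosed_I fun β a b => by
      rw [ProjTensor.mapLeft_tmul, ProjTensor.mapLeft_tmul, m.left_right]
      exact m.subset_I β (m.left α a) b)
    (fun α => m.I_le_comap (ProjTensor.mapRight (m.right α)) m.isClosed_I fun β a b => by
      rw [ProjTensor.mapRight_tmul, ProjTensor.mapRight_tmul, ← m.left_right]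
      exact m.subset_I β a (m.right α b))

/-- `A / J` as a Banach `𝔄`-bimodule. -/
def quotJ𝔄 (m : CompatibleBimodule 𝔄 A) : BanachBimodule 𝔄 m.QuotJ :=
  m.toBanachBimodule.quotient m.J m.left_mem_J m.right_mem_J

variable [IsScalarTower ℂ A A] [SMulCommClass ℂ A A]

/-- `A ⊗̂_𝔄 A` as a Banach `A`-bimodule: `c · (a ⊗ b) = c a ⊗ b`, `(a ⊗ b) · c = a ⊗ b c`. -/
def modTensorA (m : CompatibleBimodule 𝔄 A) : BanachBimodule A m.ModTensor :=
  (ProjTensor.bimodule (BanachBimodule.self A)).quotient m.I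
    (fun c => m.I_le_comap (ProjTensor.mapLeft ((BanachBimodule.self A).left c)) m.isClosed_I
      fun β a b => by
        rw [ProjTensor.mapLeft_tmul, ProjTensor.mapLeft_tmul]
        change ProjTensor.tmul (c * m.right β a) b - ProjTensor.tmul (c * a) (m.left β b) ∈ m.I
        rw [← m.right_comp]
        exact m.subset_I β (c * a) b)
    (fun c => m.I_le_comap (ProjTensor.mapRight ((BanachBimodule.self A).right c)) m.isClosed_I
      fun β a b => by
        rw [ProjTensor.mapRight_tmul, ProjTensor.mapRight_tmul]
        change ProjTensor.tmul (m.right β a) (b * c) - ProjTensor.tmul a (m.left β b * c) ∈ m.I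
        rw [← m.left_comp]
        exact m.subset_I β a (b * c))

/-- `A / J` as a Banach `A`-bimodule. -/
def quotJA (m : CompatibleBimodule 𝔄 A) : BanachBimodule A m.QuotJ :=
  (BanachBimodule.self A).quotient m.J (fun a _ hx => m.mul_mem_J a hx)
    (fun a _ hx => m.mem_J_mul a hx)

variable [CompleteSpace A]

/-- `ω̃ : A ⊗̂_𝔄 A → A / J`, `ω̃ (a ⊗ b + I) = a b + J`. -/
def omega (m : CompatibleBimodule 𝔄 A) : m.ModTensor →L[ℂ] m.QuotJ :=
  m.I.liftQL (m.J.mkQL ∘L ProjTensor.prod A) fun x hx => by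
    have : ProjTensor.prod A x ∈ m.J :=
      m.I_le_comap (ProjTensor.prod A) m.isClosed_J
        (fun α a b => by simpa using m.subset_J α a b) x hx
    simpa using this

@[simp] theorem omega_mk_tmul (m : CompatibleBimodule 𝔄 A) (a b : A) :
    m.omega (Submodule.Quotient.mk (ProjTensor.tmul a b)) = Submodule.Quotient.mk (a * b) := by
  change (Submodule.Quotient.mk (ProjTensor.prod A (ProjTensor.tmul a b)) : m.QuotJ) = _
  rw [ProjTensor.prod_tmul]

/-- `A` is module biflat (as an `𝔄`-bimodule): the adjoint `ω̃* : (A/J)* → (A ⊗̂_𝔄 A)*` has a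
bounded left inverse `θ` which is an `A/J`-`𝔄`-module homomorphism. The class `a + J` acts on
`(A/J)*` and on `(A ⊗̂_𝔄 A)*` as its representative `a` does, so being an `A/J`-bimodule map is
the same as being an `A`-bimodule map. -/
def ModuleBiflat (m : CompatibleBimodule 𝔄 A) : Prop :=
  ∃ θ : StrongDual ℂ m.ModTensor →L[ℂ] StrongDual ℂ m.QuotJ,
    (∀ f : StrongDual ℂ m.QuotJ, θ (f ∘L m.omega) = f) ∧
    m.modTensorA.dual.IsHom m.quotJA.dual θ ∧
    m.modTensor𝔄.dual.IsHom m.quotJ𝔄.dual θ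

end

end CompatibleBimodule

/-! ### The second dual with the first Arens product -/

/-- The second dual `A**` of `A`. -/
def Bidual (A : Type*) [NormedAddCommGroup A] [NormedSpace ℂ A] : Type _ :=
  StrongDual ℂ (StrongDual ℂ A)

namespace Bidual

section
variable {A : Type*} [NormedAddCommGroup A] [NormedSpace ℂ A]

instance : NormedAddCommGroup (Bidual A) :=
  inferInstanceAs (NormedAddCommGroup (StrongDual ℂ (StrongDual ℂ A)))

instance : NormedSpace ℂ (Bidual A) :=
  inferInstanceAs (NormedSpace ℂ (StrongDual ℂ (StrongDual ℂ A)))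

instance : CompleteSpace (Bidual A) :=
  inferInstanceAs (CompleteSpace (StrongDual ℂ (StrongDual ℂ A)))

/-- The identity `A** → StrongDual ℂ (StrongDual ℂ A)`, to evaluate at functionals. -/
def toDual : Bidual A →L[ℂ] StrongDual ℂ (StrongDual ℂ A) :=
  ContinuousLinearMap.id ℂ (StrongDual ℂ (StrongDual ℂ A))

/-- The identity `StrongDual ℂ (StrongDual ℂ A) → A**`. -/
def ofDual : StrongDual ℂ (StrongDual ℂ A) →L[ℂ] Bidual A :=
  ContinuousLinearMap.id ℂ (StrongDual ℂ (StrongDual ℂ A))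

@[simp] theorem toDual_ofDual (F : StrongDual ℂ (StrongDual ℂ A)) : toDual (ofDual F) = F := rfl

@[simp] theorem ofDual_toDual (F : Bidual A) : ofDual (toDual F) = F := rfl

@[simp] theorem norm_toDual (F : Bidual A) : ‖toDual F‖ = ‖F‖ := rfl

@[simp] theorem norm_ofDual (F : StrongDual ℂ (StrongDual ℂ A)) : ‖ofDual F‖ = ‖F‖ := rfl

theorem ext {F G : Bidual A} (h : ∀ f, toDual F f = toDual G f) : F = G :=
  ContinuousLinearMap.ext (f := toDual F) (g := toDual G) h

end

section
variable {A : Type*} [NonUnitalNormedRing A] [NormedSpace ℂ A] [IsScalarTower ℂ A A]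
  [SMulCommClass ℂ A A]

/-- `f · a ∈ A*`, `(f · a)(b) = f (a b)`. -/
def funMul (f : StrongDual ℂ A) (a : A) : StrongDual ℂ A := f ∘L ContinuousLinearMap.mul ℂ A a

@[simp] theorem funMul_apply (f : StrongDual ℂ A) (a b : A) : funMul f a b = f (a * b) := rfl

theorem norm_funMul_le (f : StrongDual ℂ A) (a : A) : ‖funMul f a‖ ≤ ‖f‖ * ‖a‖ :=
  (ContinuousLinearMap.opNorm_comp_le _ _).trans
    (mul_le_mul_of_nonneg_left (ContinuousLinearMap.opNorm_mul_apply_le ℂ A a) (norm_nonneg _))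

/-- `G · f ∈ A*`, `(G · f)(a) = G (f · a)`. -/
def mulFun (G : Bidual A) (f : StrongDual ℂ A) : StrongDual ℂ A :=
  LinearMap.mkContinuous
    { toFun := fun a => toDual G (funMul f a)
      map_add' := fun a b => by
        rw [← map_add]; congr 1; ext x; simp [add_mul]
      map_smul' := fun c a => by
        rw [RingHom.id_apply, ← map_smul]; congr 1; ext x; simp [smul_mul_assoc] }
    (‖G‖ * ‖f‖) fun a => by
      refine ((toDual G).le_opNorm _).trans ?_
      rw [norm_toDual, mul_assoc]
      exact mul_le_mul_of_nonneg_left (norm_funMul_le f a) (norm_nonneg _)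

@[simp] theorem mulFun_apply (G : Bidual A) (f : StrongDual ℂ A) (a : A) :
    mulFun G f a = toDual G (funMul f a) := rfl

theorem norm_mulFun_le (G : Bidual A) (f : StrongDual ℂ A) : ‖mulFun G f‖ ≤ ‖G‖ * ‖f‖ :=
  LinearMap.mkContinuous_norm_le _ (by positivity) _

/-- The first Arens product: `(F □ G)(f) = F (G · f)`. -/
def arens (F G : Bidual A) : Bidual A :=
  ofDual (LinearMap.mkContinuous
    { toFun := fun f => toDual F (mulFun G f)
      map_add' := fun f g => by
        rw [← map_add]; congr 1; ext a
        simp only [mulFun_apply, add_apply, ← map_add]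
        congr 1
      map_smul' := fun c f => by
        rw [RingHom.id_apply, ← map_smul]; congr 1; ext a
        simp only [mulFun_apply, smul_apply, ← map_smul]
        congr 1 }
    (‖F‖ * ‖G‖) fun f => by
      refine ((toDual F).le_opNorm _).trans ?_
      rw [norm_toDual, mul_assoc]
      exact mul_le_mul_of_nonneg_left (norm_mulFun_le G f) (norm_nonneg _))

theorem norm_arens_le (F G : Bidual A) : ‖arens F G‖ ≤ ‖F‖ * ‖G‖ := by
  unfold arens
  rw [norm_ofDual]
  exact LinearMap.mkContinuous_norm_le _ (by positivity) _

instance : Mul (Bidual A) := ⟨arens⟩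

@[simp] theorem mul_apply (F G : Bidual A) (f : StrongDual ℂ A) :
    toDual (F * G) f = toDual F (mulFun G f) := rfl

theorem mulFun_add (F G : Bidual A) (f : StrongDual ℂ A) :
    mulFun (F + G) f = mulFun F f + mulFun G f := by ext a; simp

theorem mulFun_smul (c : ℂ) (G : Bidual A) (f : StrongDual ℂ A) :
    mulFun (c • G) f = c • mulFun G f := by ext a; simp

theorem mulFun_mul (F G : Bidual A) (f : StrongDual ℂ A) :
    mulFun (F * G) f = mulFun F (mulFun G f) := by
  ext a
  simp only [mulFun_apply, mul_apply]
  congr 1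
  ext b
  simp only [mulFun_apply, funMul_apply]
  congr 1
  ext c
  simp [mul_assoc]

instance : NonUnitalNormedRing (Bidual A) :=
  { (inferInstance : NormedAddCommGroup (Bidual A)), (inferInstance : Mul (Bidual A)) with
    left_distrib := fun F G H => ext fun f => by simp [mulFun_add]
    right_distrib := fun F G H => ext fun f => by simp
    zero_mul := fun F => ext fun f => by simp
    mul_zero := fun F => ext fun f => by
      have : mulFun (0 : Bidual A) f = 0 := by ext a; simp
      simp [this]
    mul_assoc := fun F G H => ext fun f => by simp [mulFun_mul]
    norm_mul_le := norm_arens_le }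

instance : IsScalarTower ℂ (Bidual A) (Bidual A) :=
  ⟨fun c F G => ext fun f => by simp [smul_eq_mul]⟩

instance : SMulCommClass ℂ (Bidual A) (Bidual A) :=
  ⟨fun c F G => ext fun f => by simp [smul_eq_mul, mulFun_smul]⟩

end

end Bidual

namespace CompatibleBimodule

variable {𝔄 A : Type*} [NonUnitalNormedRing 𝔄] [NormedSpace ℂ 𝔄]
  [NonUnitalNormedRing A] [NormedSpace ℂ A] [IsScalarTower ℂ A A] [SMulCommClass ℂ A A]

/-- The second dual bimodule: `A**` with the first Arens product and the second dual actions
`(α · F)(f) = F (f · α)`, `(F · α)(f) = F (α · f)`. -/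
def bidual (m : CompatibleBimodule 𝔄 A) : CompatibleBimodule 𝔄 (Bidual A) where
  toBanachBimodule := (m.toBanachBimodule.dual.dual :
    BanachBimodule 𝔄 (StrongDual ℂ (StrongDual ℂ A)))
  left_comp α F G := Bidual.ext fun f => by
    change Bidual.toDual F (Bidual.mulFun G (m.dual.right α f)) =
      Bidual.toDual F (m.dual.right α (Bidual.mulFun G f))
    congr 1
    ext a
    change Bidual.toDual G _ = Bidual.toDual G _
    congr 1
    ext b
    simp [m.left_comp]
  right_comp α F G := Bidual.ext fun f => by
    change Bidual.toDual F (Bidual.mulFun G (m.dual.left α f)) =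
      Bidual.toDual F (Bidual.mulFun _ f)
    congr 1
    ext a
    change Bidual.toDual G _ = Bidual.toDual G (m.dual.left α _)
    congr 1
    ext b
    simp [m.right_comp]

end CompatibleBimodule

end ModBiflat

end

/-!
Functionals on `A ⊗̂_𝔄 A` are the bounded bilinear forms `φ` on `A` that are balanced,
`φ (a · α, b) = φ (a, α · b)`. Such a form has the Arens extension
`φ̃ (F, G) = F (a ↦ G (b ↦ φ (a, b)))` to `A**`, which is again balanced because the actions of `𝔄`
on `A**` are the second adjoints of those on `A`. This gives a bounded map
`Λ : (A ⊗̂_𝔄 A)* → (A** ⊗̂_𝔄 A**)*` (`arensTensor`).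

The canonical embedding `κ : A → A**` is an algebra and `𝔄`-bimodule homomorphism, so it maps
`J_A` into `J_{A**}` and induces `η : A / J_A → A** / J_{A**}` (`quotEmbed`). If `θ` is a left
inverse of the adjoint of `ω̃` for `A**`, then `η* ∘ θ ∘ Λ` is one for `A`:

* If `f ∈ A*` vanishes on `J_A`, the extension of `(a, b) ↦ f (a b)` is `(F, G) ↦ (F □ G)(f)` by
  the very definition of the first Arens product. The bipolar of `J_A` is a closed ideal of `A**`
  containing the generators of `J_{A**}` (`apply_eq_zero_of_mem_J`), so evaluation at `f` descends
  to `f̃` on `A** / J_{A**}`; thus `Λ` maps the form of `f` to `f̃ ∘ ω̃`, and `θ` sends it back to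
  `f̃`, whose restriction to `A` is `f`.
* `Λ` and `η*` commute with the actions of `𝔄`, and turn the action of `κ c` into that of `c ∈ A`.
  Here the first Arens product enters only through `G □ κ c` and `κ c □ F`.
-/

-- Normed structures on iterated spaces of operators need a deeper instance search than the default.
set_option maxSynthPendingDepth 3

noncomputable section

namespace ModBiflat

open ContinuousLinearMap

/-- A bounded functional vanishing on `S` descends to `X ⧸ S` without increase of its norm. -/
theorem norm_liftQL_le {X : Type*} [NormedAddCommGroup X] [NormedSpace ℂ X] (S : Submodule ℂ X)
    (f : StrongDual ℂ X) (h : ∀ x ∈ S, f x = 0) : ‖S.liftQL f h‖ ≤ ‖f‖ := by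
  refine ContinuousLinearMap.opNorm_le_bound _ (norm_nonneg f) fun q => ?_
  have key : ∀ δ > 0, ‖S.liftQL f h q‖ ≤ ‖f‖ * (‖q‖ + δ) := fun δ hδ => by
    obtain ⟨x, rfl, hx⟩ := Submodule.Quotient.norm_mk_lt q hδ
    exact (f.le_opNorm x).trans (by gcongr)
  refine ge_of_tendsto (x := nhdsWithin 0 (Set.Ioi (0 : ℝ)))
    (f := fun δ => ‖f‖ * (‖q‖ + δ)) ?_ (Filter.eventually_of_mem self_mem_nhdsWithin key)
  have : Continuous fun δ : ℝ => ‖f‖ * (‖q‖ + δ) := by fun_prop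
  simpa using (this.tendsto 0).mono_left nhdsWithin_le_nhds

/-! ### Bounded bilinear forms and functionals on `X ⊗̂ X` -/

namespace ProjTensor

variable {X : Type*} [NormedAddCommGroup X] [NormedSpace ℂ X]

theorem norm_tmul_le (a b : X) : ‖tmul a b‖ ≤ ‖a‖ * ‖b‖ := by
  unfold tmul
  rw [UniformSpace.Completion.norm_coe]
  simpa using PiTensorProduct.projectiveSeminorm_tprod_le (𝕜 := ℂ) (E := fun _ : Fin 2 => X) ![a, b]

/-- The bounded bilinear map `(a, b) ↦ a ⊗ b`. -/
def tmulL (X : Type*) [NormedAddCommGroup X] [NormedSpace ℂ X] : X →L[ℂ] X →L[ℂ] ProjTensor X :=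
  LinearMap.mkContinuous₂
    (LinearMap.mk₂ ℂ tmul tmul_add_left tmul_smul_left tmul_add_right tmul_smul_right)
    1 fun a b => by simpa using norm_tmul_le a b

/-- The functional on `X ⊗̂ X` with `a ⊗ b ↦ B a b`. -/
def liftForm (B : X →L[ℂ] X →L[ℂ] ℂ) : StrongDual ℂ (ProjTensor X) :=
  (PiTensorProduct.liftIsometry ℂ (fun _ : Fin 2 => X) ℂ
    (MultilinearMap.mkContinuous
      (MultilinearMap.mk' (fun v : Fin 2 → X => B (v 0) (v 1))
        (fun v i x y => by fin_cases i <;> simp)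
        (fun v i c x => by fin_cases i <;> simp))
      ‖B‖ fun v => by simpa [mul_assoc] using B.le_opNorm₂ (v 0) (v 1))).fromCompletion

@[simp] theorem liftForm_tmul (B : X →L[ℂ] X →L[ℂ] ℂ) (a b : X) :
    liftForm B (tmul a b) = B a b := by
  unfold liftForm tmul
  rw [ContinuousLinearMap.fromCompletion_apply_coe]
  simp

theorem norm_liftForm_le (B : X →L[ℂ] X →L[ℂ] ℂ) : ‖liftForm B‖ ≤ ‖B‖ := by
  refine ContinuousLinearMap.opNorm_le_bound _ (by positivity) fun x => ?_
  induction x using UniformSpace.Completion.induction_on with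
  | hp => exact isClosed_le (by fun_prop) (by fun_prop)
  | ih x =>
    unfold liftForm
    rw [ContinuousLinearMap.fromCompletion_apply_coe, UniformSpace.Completion.norm_coe]
    refine (ContinuousLinearMap.le_opNorm _ x).trans ?_
    gcongr
    rw [LinearIsometryEquiv.norm_map]
    exact MultilinearMap.mkContinuous_norm_le _ (norm_nonneg _) _

/-- `liftForm` as a bounded linear map. -/
def liftFormL (X : Type*) [NormedAddCommGroup X] [NormedSpace ℂ X] :
    (X →L[ℂ] X →L[ℂ] ℂ) →L[ℂ] StrongDual ℂ (ProjTensor X) :=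
  LinearMap.mkContinuous
    { toFun := liftForm
      map_add' := fun B C => ext_tmul fun a b => by
        rw [add_apply, liftForm_tmul, liftForm_tmul, liftForm_tmul, add_apply, add_apply]
      map_smul' := fun c B => ext_tmul fun a b => by
        rw [RingHom.id_apply, smul_apply, liftForm_tmul, liftForm_tmul, smul_apply, smul_apply] }
    1 fun B => (norm_liftForm_le B).trans_eq (one_mul _).symm

@[simp] theorem liftFormL_tmul (B : X →L[ℂ] X →L[ℂ] ℂ) (a b : X) :
    liftFormL X B (tmul a b) = B a b := liftForm_tmul B a b

end ProjTensor

/-! ### The Arens extension of a bilinear form -/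

namespace Bidual

section
variable {A : Type*} [NormedAddCommGroup A] [NormedSpace ℂ A]

/-- The Arens extension of a bilinear form: `(F, G) ↦ F (a ↦ G (b ↦ B a b))`. -/
def arensExt (A : Type*) [NormedAddCommGroup A] [NormedSpace ℂ A] :
    (A →L[ℂ] A →L[ℂ] ℂ) →L[ℂ] Bidual A →L[ℂ] Bidual A →L[ℂ] ℂ :=
  (compL ℂ (Bidual A) (StrongDual ℂ (StrongDual ℂ A)) (Bidual A →L[ℂ] ℂ)).flip (toDual (A := A)) ∘L
    (compL ℂ (Bidual A) (StrongDual ℂ A) ℂ).flip ∘L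
    (compL ℂ (Bidual A) (StrongDual ℂ (StrongDual ℂ A)) (StrongDual ℂ A)).flip (toDual (A := A)) ∘L
    (compL ℂ A (StrongDual ℂ A) ℂ).flip

@[simp] theorem arensExt_apply (B : A →L[ℂ] A →L[ℂ] ℂ) (F G : Bidual A) :
    arensExt A B F G = toDual F (toDual G ∘L B) := rfl

/-- The canonical embedding `A → A**`. -/
def incl (A : Type*) [NormedAddCommGroup A] [NormedSpace ℂ A] : A →L[ℂ] Bidual A :=
  ofDual ∘L NormedSpace.inclusionInDoubleDual ℂ A

@[simp] theorem toDual_incl (a : A) (f : StrongDual ℂ A) : toDual (incl A a) f = f a := rfl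

/-- Evaluation at `f ∈ A*`, as a functional on `A**`. -/
def evalAt (f : StrongDual ℂ A) : StrongDual ℂ (Bidual A) :=
  NormedSpace.inclusionInDoubleDual ℂ (StrongDual ℂ A) f ∘L toDual

end

theorem incl_mul {A : Type*} [NonUnitalNormedRing A] [NormedSpace ℂ A] [IsScalarTower ℂ A A]
    [SMulCommClass ℂ A A] (a b : A) : incl A (a * b) = incl A a * incl A b :=
  ext fun f => by simp

end Bidual

namespace CompatibleBimodule

open Bidual

variable {𝔄 A : Type*} [NonUnitalNormedRing 𝔄] [NormedSpace ℂ 𝔄]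
  [NonUnitalNormedRing A] [NormedSpace ℂ A]

/-! ### Balanced forms -/

/-- A functional on `A ⊗̂_𝔄 A` as a bilinear form on `A`. -/
def formL (m : CompatibleBimodule 𝔄 A) : StrongDual ℂ m.ModTensor →L[ℂ] A →L[ℂ] A →L[ℂ] ℂ :=
  LinearMap.mkContinuous
    { toFun := fun φ => compL ℂ A (ProjTensor A) ℂ (φ ∘L m.I.mkQL) ∘L ProjTensor.tmulL A
      map_add' := fun φ ψ => by ext; simp
      map_smul' := fun c φ => by ext; simp }
    1 fun φ => by
      rw [one_mul]
      refine ContinuousLinearMap.opNorm_le_bound₂ _ (by positivity) fun a b => ?_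
      change ‖φ (Submodule.Quotient.mk (ProjTensor.tmul a b))‖ ≤ _
      refine (φ.le_opNorm _).trans ?_
      rw [mul_assoc]
      gcongr
      exact (Submodule.Quotient.norm_mk_le _ _).trans (ProjTensor.norm_tmul_le a b)

theorem formL_balanced (m : CompatibleBimodule 𝔄 A) (φ : StrongDual ℂ m.ModTensor) (α : 𝔄)
    (a b : A) : m.formL φ (m.right α a) b = m.formL φ a (m.left α b) :=
  congrArg φ ((Submodule.Quotient.eq _).2 (m.subset_I α a b))

theorem modTensor_ext (m : CompatibleBimodule 𝔄 A) {φ ψ : StrongDual ℂ m.ModTensor}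
    (h : ∀ a b, φ (Submodule.Quotient.mk (ProjTensor.tmul a b)) =
      ψ (Submodule.Quotient.mk (ProjTensor.tmul a b))) : φ = ψ := by
  have : φ ∘L m.I.mkQL = ψ ∘L m.I.mkQL := ProjTensor.ext_tmul h
  ext q
  obtain ⟨x, rfl⟩ := Submodule.Quotient.mk_surjective m.I q
  exact DFunLike.congr_fun this x

theorem quotJ_ext (m : CompatibleBimodule 𝔄 A) {f g : StrongDual ℂ m.QuotJ}
    (h : ∀ a : A, f (Submodule.Quotient.mk a) = g (Submodule.Quotient.mk a)) : f = g := by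
  ext q
  obtain ⟨a, rfl⟩ := Submodule.Quotient.mk_surjective m.J q
  exact h a

variable [IsScalarTower ℂ A A] [SMulCommClass ℂ A A]

theorem toDual_bidual_left (m : CompatibleBimodule 𝔄 A) (α : 𝔄) (F : Bidual A)
    (f : StrongDual ℂ A) : toDual (m.bidual.left α F) f = toDual F (f ∘L m.left α) := rfl

theorem toDual_bidual_right (m : CompatibleBimodule 𝔄 A) (α : 𝔄) (F : Bidual A)
    (f : StrongDual ℂ A) : toDual (m.bidual.right α F) f = toDual F (f ∘L m.right α) := rfl

/-- The Arens extension of a balanced form is balanced. -/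
theorem arensExt_balanced (m : CompatibleBimodule 𝔄 A) {B : A →L[ℂ] A →L[ℂ] ℂ}
    (hB : ∀ α a b, B (m.right α a) b = B a (m.left α b)) (α : 𝔄) (F G : Bidual A) :
    arensExt A B (m.bidual.right α F) G = arensExt A B F (m.bidual.left α G) := by
  rw [arensExt_apply, arensExt_apply, toDual_bidual_right]
  congr 1
  ext a
  change toDual G (B (m.right α a)) = toDual G (B a ∘L m.left α)
  congr 1
  ext b
  exact hB α a b

/-- The functional on `A** ⊗̂ A**` given by the Arens extension of a balanced form. -/
def arensFunctional (m : CompatibleBimodule 𝔄 A) :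
    StrongDual ℂ m.ModTensor →L[ℂ] StrongDual ℂ (ProjTensor (Bidual A)) :=
  ProjTensor.liftFormL (Bidual A) ∘L arensExt A ∘L m.formL

theorem arensFunctional_tmul (m : CompatibleBimodule 𝔄 A) (φ : StrongDual ℂ m.ModTensor)
    (F G : Bidual A) : m.arensFunctional φ (ProjTensor.tmul F G) =
      toDual F (toDual G ∘L m.formL φ) :=
  ProjTensor.liftFormL_tmul _ F G

theorem arensFunctional_eq_zero (m : CompatibleBimodule 𝔄 A) (φ : StrongDual ℂ m.ModTensor) :
    ∀ x ∈ m.bidual.I, m.arensFunctional φ x = 0 :=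
  m.bidual.I_le_comap (m.arensFunctional φ) (K := ⊥) isClosed_singleton fun α F G => by
    rw [Submodule.mem_bot, arensFunctional_tmul, arensFunctional_tmul, sub_eq_zero]
    exact m.arensExt_balanced (m.formL_balanced φ) α F G

/-- `Λ : (A ⊗̂_𝔄 A)* → (A** ⊗̂_𝔄 A**)*`, the Arens extension of balanced forms. -/
def arensTensor (m : CompatibleBimodule 𝔄 A) :
    StrongDual ℂ m.ModTensor →L[ℂ] StrongDual ℂ m.bidual.ModTensor :=
  LinearMap.mkContinuous
    { toFun := fun φ => m.bidual.I.liftQL (m.arensFunctional φ) (m.arensFunctional_eq_zero φ)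
      map_add' := fun φ ψ => m.bidual.modTensor_ext fun F G =>
        DFunLike.congr_fun (map_add m.arensFunctional φ ψ) (ProjTensor.tmul F G)
      map_smul' := fun c φ => m.bidual.modTensor_ext fun F G =>
        DFunLike.congr_fun (map_smul m.arensFunctional c φ) (ProjTensor.tmul F G) }
    ‖m.arensFunctional‖ fun φ =>
      (norm_liftQL_le _ _ _).trans (m.arensFunctional.le_opNorm φ)

@[simp] theorem arensTensor_tmul (m : CompatibleBimodule 𝔄 A) (φ : StrongDual ℂ m.ModTensor)
    (F G : Bidual A) : m.arensTensor φ (Submodule.Quotient.mk (ProjTensor.tmul F G)) =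
      toDual F (toDual G ∘L m.formL φ) :=
  m.arensFunctional_tmul φ F G

/-! ### Equivariance of the Arens extension -/

theorem arensTensor_isHom (m : CompatibleBimodule 𝔄 A) :
    m.modTensor𝔄.dual.IsHom m.bidual.modTensor𝔄.dual m.arensTensor := by
  constructor
  · refine fun α φ => m.bidual.modTensor_ext fun F G => ?_
    have h : m.bidual.modTensor𝔄.right α (Submodule.Quotient.mk (ProjTensor.tmul F G)) =
        Submodule.Quotient.mk (ProjTensor.tmul F (m.bidual.right α G)) :=
      congrArg Submodule.Quotient.mk (ProjTensor.mapRight_tmul (m.bidual.right α) F G)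
    rw [BanachBimodule.dual_left_apply, h]
    refine (m.arensTensor_tmul _ F G).trans (Eq.trans ?_
      (m.arensTensor_tmul φ F (m.bidual.right α G)).symm)
    congr 1
    ext a
    change toDual G (m.formL _ a) = toDual G (m.formL φ a ∘L m.right α)
    congr 1
    ext b
    exact congrArg (fun t => φ (Submodule.Quotient.mk t))
      (ProjTensor.mapRight_tmul (m.right α) a b)
  · refine fun α φ => m.bidual.modTensor_ext fun F G => ?_
    have h : m.bidual.modTensor𝔄.left α (Submodule.Quotient.mk (ProjTensor.tmul F G)) =
        Submodule.Quotient.mk (ProjTensor.tmul (m.bidual.left α F) G) :=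
      congrArg Submodule.Quotient.mk (ProjTensor.mapLeft_tmul (m.bidual.left α) F G)
    rw [BanachBimodule.dual_right_apply, h]
    refine (m.arensTensor_tmul _ F G).trans (Eq.trans ?_
      (m.arensTensor_tmul φ (m.bidual.left α F) G).symm)
    rw [toDual_bidual_left]
    congr 1
    ext a
    change toDual G (m.formL _ a) = toDual G (m.formL φ (m.left α a))
    congr 1
    ext b
    exact congrArg (fun t => φ (Submodule.Quotient.mk t))
      (ProjTensor.mapLeft_tmul (m.left α) a b)

theorem arensTensor_left (m : CompatibleBimodule 𝔄 A) (c : A) (φ : StrongDual ℂ m.ModTensor) :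
    m.arensTensor (m.modTensorA.dual.left c φ) =
      m.bidual.modTensorA.dual.left (incl A c) (m.arensTensor φ) := by
  refine m.bidual.modTensor_ext fun F G => ?_
  have h : m.bidual.modTensorA.right (incl A c) (Submodule.Quotient.mk (ProjTensor.tmul F G)) =
      Submodule.Quotient.mk (ProjTensor.tmul F (G * incl A c)) :=
    congrArg Submodule.Quotient.mk
      (ProjTensor.mapRight_tmul ((BanachBimodule.self (Bidual A)).right (incl A c)) F G)
  rw [BanachBimodule.dual_left_apply, h]
  refine (m.arensTensor_tmul _ F G).trans (Eq.trans ?_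
      (m.arensTensor_tmul φ F (G * incl A c)).symm)
  congr 1
  ext a
  change toDual G (m.formL _ a) = toDual G (mulFun (incl A c) (m.formL φ a))
  congr 1
  ext b
  exact congrArg (fun t => φ (Submodule.Quotient.mk t))
      (ProjTensor.mapRight_tmul ((BanachBimodule.self A).right c) a b)

theorem arensTensor_right (m : CompatibleBimodule 𝔄 A) (c : A) (φ : StrongDual ℂ m.ModTensor) :
    m.arensTensor (m.modTensorA.dual.right c φ) =
      m.bidual.modTensorA.dual.right (incl A c) (m.arensTensor φ) := by
  refine m.bidual.modTensor_ext fun F G => ?_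
  have h : m.bidual.modTensorA.left (incl A c) (Submodule.Quotient.mk (ProjTensor.tmul F G)) =
      Submodule.Quotient.mk (ProjTensor.tmul (incl A c * F) G) :=
    congrArg Submodule.Quotient.mk
      (ProjTensor.mapLeft_tmul ((BanachBimodule.self (Bidual A)).left (incl A c)) F G)
  rw [BanachBimodule.dual_right_apply, h]
  refine (m.arensTensor_tmul _ F G).trans (Eq.trans ?_
      (m.arensTensor_tmul φ (incl A c * F) G).symm)
  -- `(κ c □ F)(h) = κ c (F · h) = F (h · c)`.
  change toDual F (toDual G ∘L m.formL _) = toDual F (funMul (toDual G ∘L m.formL φ) c)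
  congr 1
  ext a
  change toDual G (m.formL _ a) = toDual G (m.formL φ (c * a))
  congr 1
  ext b
  exact congrArg (fun t => φ (Submodule.Quotient.mk t))
      (ProjTensor.mapLeft_tmul ((BanachBimodule.self A).left c) a b)

/-! ### The quotients `A / J` and `A** / J` -/

/-- `J_{A**}` lies in the bipolar of `J_A`. -/
theorem apply_eq_zero_of_mem_J (m : CompatibleBimodule 𝔄 A) {F : Bidual A} (hF : F ∈ m.bidual.J)
    {f : StrongDual ℂ A} (hf : ∀ x ∈ m.J, f x = 0) : toDual F f = 0 := by
  let K : Submodule ℂ (Bidual A) :=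
    ⨅ g : {g : StrongDual ℂ A // ∀ x ∈ m.J, g x = 0}, (evalAt g.1).ker
  have mem_K (G : Bidual A) :
      G ∈ K ↔ ∀ g : StrongDual ℂ A, (∀ x ∈ m.J, g x = 0) → toDual G g = 0 := by
    simp only [K, Submodule.mem_iInf, Subtype.forall]
    rfl
  refine (mem_K F).1 (m.bidual.J_le (K := K) ?_ ?_ ?_ hF) f hf
  · simp only [K, Submodule.coe_iInf]
    exact isClosed_iInter fun g => (evalAt g.1).isClosed_ker
  · refine fun α G H => (mem_K _).2 fun g hg => ?_
    -- The form `(a, b) ↦ g (a b)` is balanced, and its Arens extension is `(G, H) ↦ (G □ H)(g)`.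
    have := m.arensExt_balanced (B := compL ℂ A A ℂ g ∘L ContinuousLinearMap.mul ℂ A)
      (fun α a b => sub_eq_zero.1 ((map_sub g _ _).symm.trans (hg _ (m.subset_J α a b)))) α G H
    rw [map_sub, sub_apply, sub_eq_zero]
    exact this
  · refine fun G H hH => ⟨(mem_K _).2 fun g hg => ?_, (mem_K _).2 fun g hg => ?_⟩
    · have : mulFun H g = 0 := by
        ext a
        exact (mem_K H).1 hH _ fun x hx => hg _ (m.mul_mem_J a hx)
      rw [mul_apply, this, map_zero]
    · refine (mem_K H).1 hH _ fun x hx => ?_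
      have : funMul g x = 0 := by
        ext b
        exact hg _ (m.mem_J_mul b hx)
      rw [mulFun_apply, this, map_zero]

theorem incl_left (m : CompatibleBimodule 𝔄 A) (α : 𝔄) (a : A) :
    incl A (m.left α a) = m.bidual.left α (incl A a) := rfl

theorem incl_right (m : CompatibleBimodule 𝔄 A) (α : 𝔄) (a : A) :
    incl A (m.right α a) = m.bidual.right α (incl A a) := rfl

theorem incl_mem_J (m : CompatibleBimodule 𝔄 A) {x : A} (hx : x ∈ m.J) :
    incl A x ∈ m.bidual.J := by
  have : m.J ≤ m.bidual.J.comap (incl A).toLinearMap := by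
    refine m.J_le (m.bidual.isClosed_J.preimage (incl A).continuous) ?_ ?_
    · intro α a b
      change incl A _ ∈ m.bidual.J
      rw [map_sub, incl_mul, incl_mul, incl_left, incl_right]
      exact m.bidual.subset_J α _ _
    · intro a x hx
      constructor
      · change incl A (a * x) ∈ m.bidual.J
        rw [incl_mul]
        exact m.bidual.mul_mem_J _ hx
      · change incl A (x * a) ∈ m.bidual.J
        rw [incl_mul]
        exact m.bidual.mem_J_mul _ hx
  exact this hx

/-- `η : A / J_A → A** / J_{A**}`, induced by the canonical embedding. -/
def quotEmbed (m : CompatibleBimodule 𝔄 A) : m.QuotJ →L[ℂ] m.bidual.QuotJ :=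
  m.J.liftQL (m.bidual.J.mkQL ∘L incl A) fun x hx => by
    simpa using m.incl_mem_J hx

/-- The functional that `f ∈ (A / J_A)*` defines on `A** / J_{A**}` by evaluation at `f`. -/
def quotEval (m : CompatibleBimodule 𝔄 A) (f : StrongDual ℂ m.QuotJ) :
    StrongDual ℂ m.bidual.QuotJ :=
  m.bidual.J.liftQL (evalAt (f ∘L m.J.mkQL)) fun _ hF =>
    m.apply_eq_zero_of_mem_J hF fun _ hx =>
      (congrArg f ((Submodule.Quotient.mk_eq_zero _).2 hx)).trans (map_zero f)

theorem quotEval_mk (m : CompatibleBimodule 𝔄 A) (f : StrongDual ℂ m.QuotJ) (F : Bidual A) :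
    m.quotEval f (Submodule.Quotient.mk F) = toDual F (f ∘L m.J.mkQL) := rfl

/-- The Arens extension of `(a, b) ↦ f (a b)` is `(F, G) ↦ (F □ G)(f)`. -/
theorem arensTensor_comp_omega [CompleteSpace A] (m : CompatibleBimodule 𝔄 A)
    (f : StrongDual ℂ m.QuotJ) :
    m.arensTensor (f ∘L m.omega) = m.quotEval f ∘L m.bidual.omega := by
  refine m.bidual.modTensor_ext fun F G => ?_
  rw [comp_apply, omega_mk_tmul, quotEval_mk, arensTensor_tmul, mul_apply]
  congr 1
  ext a
  change toDual G (m.formL (f ∘L m.omega) a) = toDual G (funMul (f ∘L m.J.mkQL) a)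
  congr 1
  ext b
  exact congrArg f (m.omega_mk_tmul a b)

end CompatibleBimodule

end ModBiflat

end

theorem mainTheorem2 {𝔄 A : Type*}
    [NonUnitalNormedRing 𝔄] [NormedSpace ℂ 𝔄] [IsScalarTower ℂ 𝔄 𝔄] [SMulCommClass ℂ 𝔄 𝔄]
    [CompleteSpace 𝔄]
    [NonUnitalNormedRing A] [NormedSpace ℂ A] [IsScalarTower ℂ A A] [SMulCommClass ℂ A A]
    [CompleteSpace A]
    (m : ModBiflat.CompatibleBimodule 𝔄 A) (h : m.bidual.ModuleBiflat) :
    m.ModuleBiflat := by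
  obtain ⟨θ, hθ, hA, h𝔄⟩ := h
  -- The witness is `η* ∘ θ ∘ Λ`.
  refine ⟨(ContinuousLinearMap.compL ℂ m.QuotJ m.bidual.QuotJ ℂ).flip m.quotEmbed ∘L θ ∘L
    m.arensTensor, fun f => m.quotJ_ext fun a => ?_, ⟨fun c φ => m.quotJ_ext fun a => ?_,
    fun c φ => m.quotJ_ext fun a => ?_⟩, ⟨fun α φ => m.quotJ_ext fun a => ?_,
    fun α φ => m.quotJ_ext fun a => ?_⟩⟩
  · change θ (m.arensTensor (f ∘L m.omega)) _ = _
    rw [m.arensTensor_comp_omega, hθ]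
    rfl
  · change θ (m.arensTensor _) (Submodule.Quotient.mk (ModBiflat.Bidual.incl A a)) =
      θ (m.arensTensor φ) (Submodule.Quotient.mk (ModBiflat.Bidual.incl A (a * c)))
    rw [m.arensTensor_left, hA.1, ModBiflat.Bidual.incl_mul]
    rfl
  · change θ (m.arensTensor _) (Submodule.Quotient.mk (ModBiflat.Bidual.incl A a)) =
      θ (m.arensTensor φ) (Submodule.Quotient.mk (ModBiflat.Bidual.incl A (c * a)))
    rw [m.arensTensor_right, hA.2, ModBiflat.Bidual.incl_mul]
    rfl
  · change θ (m.arensTensor _) (Submodule.Quotient.mk (ModBiflat.Bidual.incl A a)) =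
      θ (m.arensTensor φ) (Submodule.Quotient.mk (ModBiflat.Bidual.incl A (m.right α a)))
    rw [m.arensTensor_isHom.1, h𝔄.1, m.incl_right]
    rfl
  · change θ (m.arensTensor _) (Submodule.Quotient.mk (ModBiflat.Bidual.incl A a)) =
      θ (m.arensTensor φ) (Submodule.Quotient.mk (ModBiflat.Bidual.incl A (m.left α a)))
    rw [m.arensTensor_isHom.2, h𝔄.2, m.incl_left]
    rfl
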